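/- For a finite simple graph $G$ with vertex set $V$, minimum degree $\delta(G)$ and order $|G|$, let $\mu(G)=\delta(G)/(|G|-1)$ be its strong density (with the convention $\mu(G)=0$ if $|G|=1$). The homogeneous Kuramoto model on $G$ is the system $$\dot\theta_v=\sum_{u\sim v}\sin(\theta_u-\theta_v),\qquad v\in V .$$ It is the gradient system $\dot\theta=-\nabla U$ of $U(\theta)=\sum_{uv\in E}(1-\cos(\theta_u-\theta_v))$. A point $\theta\in\mathbb R^V$ is an equilibrium if all right-hand sides vanish; it is a consensus if all $\theta_v$ are equal modulo $2\pi$; an equilibrium is linearly stable if all eigenvalues of the Hessian $U''_\theta$ on the hyperplane orthogonal to $(1,\dots,1)$ are positive. $G$ synchronizes if for Lebesgue-almost every initial condition in $\mathbb R^V$ the orbit converges, modulo $2\pi$, to some $(c,\dots,c)$. The critical connectivity $\mu_c$ is the infimum of all real $\mu$ such that every finite simple graph $G$ (with at least one vertex) with $\mu(G)>\mu$ synchronizes. For non-negative integers $p=(a,b,c,d)$ let $G_p$ be the weighted graph on $\mathbb Z_8$ whose edges are $(2i)(2i+1)$ with weight $a$, $(2i+1)(2i+2)$ with weight $c$, $(2i)(2i+5)$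 with weight $d$ (each for $i=0,1,2,3$), and $i(i+2)$ with weight $b$ (for $i\in\mathbb Z_8$). For a weighted graph $G$ with weights $w_{uv}\le k$, each edge being written with its endpoints in a fixed order, the $k$-spinning $S_k(G)$ is the simple graph on $V\times\mathbb Z_k$ in which $(u,i)(u,j)$ is an edge for all $u$ and $i\ne j$, and, for every edge written $uv$, $(u,i)(v,j)$ is an edge whenever $j\in i+\{0,1,\dots,w_{uv}-1\}$. The edges of $G_p$ are written in the order displayed above. Theorem. The critical connectivity satisfies $\mu_c\ge 11/16$. Moreover, for every integer $k\ge1$, with $p_k=(k,k,k,\lceil k/2\rceil-1)$, the graph $S_k(G_{p_k})$ has $8k$ vertices, is regular of degree $5k+\lceil k/2\rceil-2$, has a linearly stable equilibrium that is not a consensus, and does not synchronize; and $\mu(S_k(G_{p_k}))\to 11/16$ as $k\to\infty$. -/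

import Mathlib

open Filter Topology MeasureTheory

noncomputable section

/-! ### The homogeneous Kuramoto model on a finite simple graph -/

/-- The strong density `δ(G) / (|G| - 1)`. -/
def strongDensity {V : Type*} [Fintype V] (G : SimpleGraph V) [DecidableRel G.Adj] : ℝ :=
  (G.minDegree : ℝ) / ((Fintype.card V : ℝ) - 1)

/-- The right-hand side `∑_{u ∼ v} sin (θ_u - θ_v)` of the Kuramoto system. -/
def kuramotoField {V : Type*} [Fintype V] (G : SimpleGraph V) [DecidableRel G.Adj]
    (θ : V → ℝ) : V → ℝ :=
  fun v => ∑ u ∈ G.neighborFinset v, Real.sin (θ u - θ v)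

/-- `θ` is a solution, defined for all times, of `θ' = kuramotoField G θ`. -/
def IsKuramotoSolution {V : Type*} [Fintype V] (G : SimpleGraph V) [DecidableRel G.Adj]
    (θ : ℝ → V → ℝ) : Prop :=
  ∀ t : ℝ, HasDerivAt θ (kuramotoField G (θ t)) t

def IsKuramotoEquilibrium {V : Type*} [Fintype V] (G : SimpleGraph V) [DecidableRel G.Adj]
    (θ : V → ℝ) : Prop :=
  ∀ v, ∑ u ∈ G.neighborFinset v, Real.sin (θ u - θ v) = 0

/-- All phases agree as points of the circle `ℝ / 2πℤ`. -/
def IsConsensus {V : Type*} (θ : V → ℝ) : Prop :=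
  ∃ c : Real.Angle, ∀ v, (θ v : Real.Angle) = c

/-- The orbit converges, on the torus `(ℝ / 2πℤ)^V`, to a consensus `(c, …, c)`. -/
def TendsToConsensus {V : Type*} (θ : ℝ → V → ℝ) : Prop :=
  ∃ c : Real.Angle, ∀ v, Tendsto (fun t => (θ t v : Real.Angle)) atTop (𝓝 c)

/-- Almost every initial condition (for Lebesgue measure) lies on an orbit that tends to a
consensus. The vector field is globally Lipschitz, so exactly one orbit starts at each point. -/
def Synchronizes {V : Type*} [Fintype V] (G : SimpleGraph V) [DecidableRel G.Adj] : Prop :=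
  ∀ᵐ x : V → ℝ ∂volume,
    ∃ θ : ℝ → V → ℝ, IsKuramotoSolution G θ ∧ θ 0 = x ∧ TendsToConsensus θ

/-- The critical connectivity `μ_c`: the least `μ` such that every finite simple graph with
strong density greater than `μ` synchronizes. -/
def criticalConnectivity : ℝ :=
  sInf {μ : ℝ | ∀ (V : Type) [Fintype V] [Nonempty V] (G : SimpleGraph V) [DecidableRel G.Adj],
    μ < strongDensity G → Synchronizes G}

/-- The potential energy `∑_{uv ∈ E} (1 - cos (θ_u - θ_v))`, as half the sum over ordered pairs. -/
def kuramotoPotential {V : Type*} [Fintype V] (G : SimpleGraph V) [DecidableRel G.Adj]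
    (θ : V → ℝ) : ℝ :=
  (1 / 2) * ∑ v, ∑ u ∈ G.neighborFinset v, (1 - Real.cos (θ u - θ v))

open Classical in
/-- The Hessian matrix of the potential energy at `θ`. -/
def kuramotoHessian {V : Type*} [Fintype V] (G : SimpleGraph V) [DecidableRel G.Adj]
    (θ : V → ℝ) : Matrix V V ℝ :=
  fun u v =>
    if u = v then ∑ z ∈ G.neighborFinset u, Real.cos (θ u - θ z)
    else if G.Adj u v then -Real.cos (θ u - θ v)
    else 0

/-- The Kuramoto system is the gradient system `θ' = -∇U` of the potential energy `U`. -/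
theorem hasFDerivAt_kuramotoPotential {V : Type*} [Fintype V] (G : SimpleGraph V)
    [DecidableRel G.Adj] (θ : V → ℝ) :
    HasFDerivAt (kuramotoPotential G)
      (-∑ v, kuramotoField G θ v • ContinuousLinearMap.proj (R := ℝ) (φ := fun _ : V => ℝ) v)
      θ := by
  have h : ∀ v u : V, HasFDerivAt (fun θ : V → ℝ => 1 - Real.cos (θ u - θ v))
      (Real.sin (θ u - θ v) • (ContinuousLinearMap.proj (R := ℝ) (φ := fun _ : V => ℝ) u -
        ContinuousLinearMap.proj (R := ℝ) (φ := fun _ : V => ℝ) v)) θ := by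
    intro v u
    have h1 := ((hasFDerivAt_apply (𝕜 := ℝ) u θ).sub (hasFDerivAt_apply (𝕜 := ℝ) v θ)).cos
    refine (h1.const_sub 1).congr_fderiv ?_
    refine ContinuousLinearMap.ext fun x => ?_
    change -(-Real.sin (θ u - θ v) * (x u - x v)) = Real.sin (θ u - θ v) * (x u - x v)
    ring
  have h2 := (HasFDerivAt.fun_sum (u := Finset.univ) fun v _ =>
    HasFDerivAt.fun_sum (u := G.neighborFinset v) fun u _ => h v u).const_mul (1 / 2)
  refine h2.congr_fderiv ?_
  refine ContinuousLinearMap.ext fun x => ?_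
  simp only [SimpleGraph.neighborFinset_eq_filter, Finset.sum_filter, kuramotoField,
    smul_apply, sum_apply, neg_apply,
    smul_eq_mul, sub_apply, ContinuousLinearMap.proj_apply, Finset.sum_mul,
    apply_ite (fun L : (V → ℝ) →L[ℝ] ℝ => L x), zero_apply]
  have h3 : ∑ v, ∑ u, (if G.Adj v u then Real.sin (θ u - θ v) * x u else 0) =
      -∑ v, ∑ u, (if G.Adj v u then Real.sin (θ u - θ v) * x v else 0) := by
    rw [Finset.sum_comm, ← Finset.sum_neg_distrib]
    refine Finset.sum_congr rfl fun v _ => ?_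
    rw [← Finset.sum_neg_distrib]
    refine Finset.sum_congr rfl fun u _ => ?_
    rw [← neg_sub (θ u), Real.sin_neg]
    by_cases huv : G.Adj v u
    · rw [if_pos huv, if_pos huv.symm]
      ring
    · rw [if_neg huv, if_neg fun h => huv h.symm, neg_zero]
  have h4 : ∑ v, ∑ u, (if G.Adj v u then Real.sin (θ u - θ v) * (x u - x v) else 0) =
      ∑ v, ∑ u, (if G.Adj v u then Real.sin (θ u - θ v) * x u else 0) -
      ∑ v, ∑ u, (if G.Adj v u then Real.sin (θ u - θ v) * x v else 0) := by
    simp only [← Finset.sum_sub_distrib]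
    refine Finset.sum_congr rfl fun v _ => Finset.sum_congr rfl fun u _ => ?_
    split_ifs <;> ring
  simp only [ite_mul, zero_mul]
  rw [h4, h3]
  ring

/-- The Jacobian matrix of the vector field `-∇U` is minus the Hessian matrix. -/
theorem hasFDerivAt_kuramotoField {V : Type*} [Fintype V] (G : SimpleGraph V)
    [DecidableRel G.Adj] (θ : V → ℝ) :
    HasFDerivAt (kuramotoField G)
      (-(kuramotoHessian G θ).mulVecLin.toContinuousLinearMap) θ := by
  rw [hasFDerivAt_pi']
  intro v
  have h2 := HasFDerivAt.fun_sum (u := G.neighborFinset v) fun u _ =>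
    ((hasFDerivAt_apply (𝕜 := ℝ) u θ).sub (hasFDerivAt_apply (𝕜 := ℝ) v θ)).sin
  refine h2.congr_fderiv ?_
  refine ContinuousLinearMap.ext fun x => ?_
  classical
  have h3 : (kuramotoHessian G θ).mulVec x v =
      ∑ u, if G.Adj v u then Real.cos (θ v - θ u) * (x v - x u) else 0 := by
    have h4 : ∀ u, kuramotoHessian G θ v u * x u =
        (if u = v then (∑ z ∈ G.neighborFinset v, Real.cos (θ v - θ z)) * x v else 0) +
        (if G.Adj v u then -Real.cos (θ v - θ u) * x u else 0) := by
      intro u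
      unfold kuramotoHessian
      by_cases huv : v = u
      · subst huv
        simp
      · rw [if_neg huv, if_neg (Ne.symm huv)]
        split_ifs <;> ring
    simp only [Matrix.mulVec, dotProduct, h4, Finset.sum_add_distrib, Finset.sum_ite_eq',
      Finset.mem_univ, if_true, SimpleGraph.neighborFinset_eq_filter, Finset.sum_filter,
      Finset.sum_mul, ite_mul, zero_mul]
    rw [← Finset.sum_add_distrib]
    refine Finset.sum_congr rfl fun u _ => ?_
    split_ifs <;> ring
  change _ = -((kuramotoHessian G θ).mulVec x v)
  rw [h3, sum_apply, SimpleGraph.neighborFinset_eq_filter, Finset.sum_filter,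
    ← Finset.sum_neg_distrib]
  refine Finset.sum_congr rfl fun u _ => ?_
  split_ifs
  · change Real.cos (θ u - θ v) * (x u - x v) = _
    rw [← neg_sub (θ v), Real.cos_neg]
    ring
  · simp

/-- An equilibrium at which every eigenvalue of the Hessian on the hyperplane orthogonal to
`(1, …, 1)` is positive. -/
def IsLinearlyStableEquilibrium {V : Type*} [Fintype V] (G : SimpleGraph V)
    [DecidableRel G.Adj] (θ : V → ℝ) : Prop :=
  IsKuramotoEquilibrium G θ ∧
    ∀ (l : ℝ) (x : V → ℝ), x ≠ 0 → ∑ v, x v = 0 →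
      (kuramotoHessian G θ).mulVec x = l • x → 0 < l

/-! ### Weighted graphs and their spinnings -/

/-- A simple graph with natural number weights on its edges (the values of `weight` off the
edge set play no role), each edge being written in a definite order of its two endpoints:
`arc u v` says that the edge is written `uv`. -/
structure WeightedGraph (V : Type*) where
  graph : SimpleGraph V
  weight : Sym2 V → ℕ
  arc : V → V → Prop
  arc_or : ∀ u v, graph.Adj u v ↔ arc u v ∨ arc v u
  arc_asymm : ∀ u v, arc u v → ¬ arc v u

/-- The `k`-spinning: vertex set `V × ℤ_k`; all edges inside each fibre, and, for every edge
written `uv`, the edges `(u,i)(v,j)` with `j ∈ i + {0, …, w_{uv} - 1}`. -/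
def spinning {V : Type*} (G : WeightedGraph V) (k : ℕ) : SimpleGraph (V × ZMod k) :=
  SimpleGraph.fromRel fun x y =>
    (x.1 = y.1 ∧ x.2 ≠ y.2) ∨
      (G.arc x.1 y.1 ∧ ∃ h : ℕ, h < G.weight s(x.1, y.1) ∧ y.2 = x.2 + (h : ZMod k))

instance spinningDecidableRel {V : Type*} (G : WeightedGraph V) (k : ℕ) :
    DecidableRel (spinning G k).Adj := Classical.decRel _

/-! ### The weighted graphs `G_p` on `ℤ_8` -/

/-- `E_a`: the pairs `(2i)(2i+1)`. -/
def arcA (u v : ZMod 8) : Prop := ∃ i : Fin 4, u = 2 * (i : ℕ) ∧ v = 2 * (i : ℕ) + 1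

/-- `E_b`: the pairs `i(i+2)`. -/
def arcB (u v : ZMod 8) : Prop := v = u + 2

/-- `E_c`: the pairs `(2i+1)(2i+2)`. -/
def arcC (u v : ZMod 8) : Prop := ∃ i : Fin 4, u = 2 * (i : ℕ) + 1 ∧ v = 2 * (i : ℕ) + 2

/-- `E_d`: the pairs `(2i)(2i+5)`. -/
def arcD (u v : ZMod 8) : Prop := ∃ i : Fin 4, u = 2 * (i : ℕ) ∧ v = 2 * (i : ℕ) + 5

instance arcADecidable : DecidableRel arcA := fun u v => by unfold arcA; infer_instance
instance arcBDecidable : DecidableRel arcB := fun u v => by unfold arcB; infer_instance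
instance arcCDecidable : DecidableRel arcC := fun u v => by unfold arcC; infer_instance
instance arcDDecidable : DecidableRel arcD := fun u v => by unfold arcD; infer_instance

/-- `G_p` for `p = (a, b, c, d)`; edges of `E_t` have weight `t`. -/
def weightedG (a b c d : ℕ) : WeightedGraph (ZMod 8) where
  graph := SimpleGraph.fromRel fun u v => arcA u v ∨ arcB u v ∨ arcC u v ∨ arcD u v
  weight := Sym2.lift ⟨fun u v =>
    if arcA u v ∨ arcA v u then a
    else if arcB u v ∨ arcB v u then b
    else if arcC u v ∨ arcC v u then c
    else if arcD u v ∨ arcD v u then d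
    else 0, fun u v => by simp only [or_comm]⟩
  arc := fun u v => arcA u v ∨ arcB u v ∨ arcC u v ∨ arcD u v
  arc_or := by
    intro u v
    rw [SimpleGraph.fromRel_adj]
    revert u v
    decide
  arc_asymm := by decide

/-- `S_k(G_{p_k})` with `p_k = (k, k, k, ⌈k/2⌉ - 1)`. -/
abbrev spinG (k : ℕ) : SimpleGraph (ZMod 8 × ZMod k) :=
  spinning (weightedG k k k (⌈(k : ℝ) / 2⌉₊ - 1)) k

end

/-! Write d = ⌈k/2⌉ - 1. Put the fibre over 2i at phase iπ/2 and the fibre over 2i+1 at iπ/2 + φ.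
The edges over `E_b` join phases a quarter turn apart: their forces cancel in pairs and their
cosines vanish, so they raise the degree without affecting stability. The other forces balance when
tan φ = k/(k - d), which is `isKuramotoEquilibrium_twistedState`.

In the Hessian form only the edges over `E_d` have negative coefficients. Splitting a vector into
fibre means and deviations bounds the form below by two separate parts. The deviations are
controlled by the complete graphs inside fibres and the complete bipartite graphs over `E_a` and
`E_c`. The means enter through the eight-variable `ringForm`, and `eq_of_ringForm_nonpos` shows that
it is positive modulo constants as soon as 2d < k. Since d is the largest such integer, the degree
is about 11k/2 on 8k vertices, whence 11/16.

A positive Hessian form makes the equilibrium Lyapunov stable modulo translation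
(`exists_open_forall_norm_centered_lt`). A whole open set of orbits then stays away from consensus,
which contradicts almost sure synchronization. Letting k grow bounds the critical connectivity. -/

/-! ### Positive Hessian form, Lyapunov stability and failure of synchronization. -/

section Stability

variable {V : Type*} [Fintype V] (G : SimpleGraph V) [DecidableRel G.Adj]

/-- Twice the quadratic form of the Hessian, as a sum over ordered pairs of adjacent vertices. -/
noncomputable def hessianForm (θ x : V → ℝ) : ℝ :=
  ∑ v, ∑ u ∈ G.neighborFinset v, Real.cos (θ v - θ u) * (x v - x u) ^ 2

lemma sum_neighborFinset_comm (F : V → V → ℝ) :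
    ∑ v, ∑ u ∈ G.neighborFinset v, F v u = ∑ v, ∑ u ∈ G.neighborFinset v, F u v := by
  simp only [SimpleGraph.neighborFinset_eq_filter, Finset.sum_filter]
  rw [Finset.sum_comm]
  simp only [G.adj_comm]

lemma kuramotoHessian_mulVec (θ x : V → ℝ) (v : V) :
    (kuramotoHessian G θ).mulVec x v =
      ∑ u ∈ G.neighborFinset v, Real.cos (θ v - θ u) * (x v - x u) := by
  classical
  have h4 : ∀ u, kuramotoHessian G θ v u * x u =
      (if u = v then (∑ z ∈ G.neighborFinset v, Real.cos (θ v - θ z)) * x v else 0) +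
      (if G.Adj v u then -Real.cos (θ v - θ u) * x u else 0) := by
    intro u
    unfold kuramotoHessian
    by_cases huv : v = u
    · subst huv
      simp
    · rw [if_neg huv, if_neg (Ne.symm huv)]
      split_ifs <;> ring
  simp only [Matrix.mulVec, dotProduct, h4, Finset.sum_add_distrib, Finset.sum_ite_eq',
    Finset.mem_univ, if_true, SimpleGraph.neighborFinset_eq_filter, Finset.sum_filter,
    Finset.sum_mul, ite_mul, zero_mul]
  rw [← Finset.sum_add_distrib]
  refine Finset.sum_congr rfl fun u _ => ?_
  split_ifs <;> ring

lemma hessianForm_eq_two_mul (θ x : V → ℝ) :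
    hessianForm G θ x = 2 * ∑ v, x v * (kuramotoHessian G θ).mulVec x v := by
  have h := sum_neighborFinset_comm G fun v u => x v * (Real.cos (θ v - θ u) * (x v - x u))
  simp only [kuramotoHessian_mulVec, Finset.mul_sum (s := G.neighborFinset _)]
  rw [two_mul]
  nth_rewrite 2 [h]
  simp only [hessianForm, ← Finset.sum_add_distrib]
  refine Finset.sum_congr rfl fun v _ => Finset.sum_congr rfl fun u _ => ?_
  rw [← neg_sub (θ v), Real.cos_neg]
  ring

/-- A positive definite Hessian form gives linear stability. -/
lemma IsKuramotoEquilibrium.isLinearlyStable {θ : V → ℝ} (h : IsKuramotoEquilibrium G θ)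
    (hpos : ∀ x : V → ℝ, x ≠ 0 → ∑ v, x v = 0 → 0 < hessianForm G θ x) :
    IsLinearlyStableEquilibrium G θ := by
  refine ⟨h, fun l x hx hs hl => ?_⟩
  have h1 := hpos x hx hs
  rw [hessianForm_eq_two_mul, hl] at h1
  have h2 : ∑ v, x v * (l • x) v = l * ∑ v, x v ^ 2 := by
    rw [Finset.mul_sum]
    refine Finset.sum_congr rfl fun v _ => ?_
    simp only [Pi.smul_apply, smul_eq_mul]
    ring
  rw [h2] at h1
  have h3 : 0 ≤ ∑ v, x v ^ 2 := Finset.sum_nonneg fun v _ => sq_nonneg _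
  by_contra hl0
  nlinarith

lemma continuous_hessianForm (θ : V → ℝ) : Continuous (hessianForm G θ) := by
  unfold hessianForm
  fun_prop

lemma hessianForm_smul (θ x : V → ℝ) (c : ℝ) :
    hessianForm G θ (c • x) = c ^ 2 * hessianForm G θ x := by
  simp only [hessianForm, Finset.mul_sum, Pi.smul_apply, smul_eq_mul]
  refine Finset.sum_congr rfl fun v _ => Finset.sum_congr rfl fun u _ => ?_
  ring

/-- A form that is positive on sum-zero vectors is bounded below by a multiple of `‖x‖ ^ 2`. -/
lemma exists_mul_norm_sq_le_hessianForm {θ : V → ℝ}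
    (hpos : ∀ x : V → ℝ, x ≠ 0 → ∑ v, x v = 0 → 0 < hessianForm G θ x) :
    ∃ l > 0, ∀ x : V → ℝ, ∑ v, x v = 0 → l * ‖x‖ ^ 2 ≤ hessianForm G θ x := by
  have hcomp : IsCompact (Metric.sphere (0 : V → ℝ) 1 ∩ {x | ∑ v, x v = 0}) :=
    (isCompact_sphere _ _).inter_right (isClosed_eq (by fun_prop) continuous_const)
  obtain ⟨l, hl, hbound⟩ : ∃ l > 0, ∀ x ∈ Metric.sphere (0 : V → ℝ) 1 ∩ {x | ∑ v, x v = 0},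
      l ≤ hessianForm G θ x := by
    rcases (Metric.sphere (0 : V → ℝ) 1 ∩ {x | ∑ v, x v = 0}).eq_empty_or_nonempty with he | hne
    -- With at most one vertex there is no unit vector of sum zero, and any constant serves.
    · exact ⟨1, one_pos, fun x hx => by simp [he] at hx⟩
    · obtain ⟨y, hy, hmin⟩ := hcomp.exists_isMinOn hne (continuous_hessianForm G θ).continuousOn
      refine ⟨hessianForm G θ y, hpos y ?_ hy.2, fun x hx => hmin hx⟩
      rintro rfl
      simp at hy
  refine ⟨l, hl, fun x hx => ?_⟩
  rcases eq_or_ne x 0 with rfl | hx0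
  · simp [hessianForm]
  have hn : 0 < ‖x‖ := norm_pos_iff.mpr hx0
  have h1 := hbound (‖x‖⁻¹ • x) ⟨by simp [norm_smul, hn.ne'], by
    simp [← Finset.mul_sum, hx]⟩
  rw [hessianForm_smul, inv_pow, inv_mul_eq_div, le_div_iff₀ (by positivity)] at h1
  exact h1

/-- Second order Taylor expansion of the cosine. -/
lemma cos_add_le (a h : ℝ) (hh : |h| ≤ 1) :
    Real.cos (a + h) ≤ Real.cos a - Real.sin a * h - Real.cos a * h ^ 2 / 2 + |h| ^ 3 := by
  have hc := Real.cos_bound hh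
  have hs := Real.sin_bound hh
  have h0 := abs_nonneg h
  have hs' : |Real.sin h - h| ≤ |h| ^ 3 * (1 / 2) := by
    have h4 : |Real.sin h - h| ≤ |Real.sin h - (h - h ^ 3 / 6)| + |h ^ 3 / 6| := by
      have := abs_sub (Real.sin h - (h - h ^ 3 / 6)) (h ^ 3 / 6)
      calc _ = |Real.sin h - (h - h ^ 3 / 6) - h ^ 3 / 6| := by ring_nf
        _ ≤ _ := this
    rw [abs_div, abs_pow, abs_of_pos (show (0 : ℝ) < 6 by norm_num)] at h4
    have : |h| ^ 5 ≤ |h| ^ 3 := pow_le_pow_of_le_one h0 hh (by norm_num)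
    have : 0 ≤ |h| ^ 3 := by positivity
    linarith
  have hc' : |Real.cos h - (1 - h ^ 2 / 2)| ≤ |h| ^ 3 * (1 / 2) := by
    have : |h| ^ 4 ≤ |h| ^ 3 := pow_le_pow_of_le_one h0 hh (by norm_num)
    have : 0 ≤ |h| ^ 3 := by positivity
    linarith
  have e1 : Real.cos a * (Real.cos h - (1 - h ^ 2 / 2)) ≤ |h| ^ 3 * (1 / 2) := by
    refine (le_abs_self _).trans ?_
    rw [abs_mul]
    exact (mul_le_of_le_one_left (abs_nonneg _) (Real.abs_cos_le_one a)).trans hc'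
  have e2 : -(Real.sin a * (Real.sin h - h)) ≤ |h| ^ 3 * (1 / 2) := by
    refine (neg_le_abs _).trans ?_
    rw [abs_mul]
    exact (mul_le_of_le_one_left (abs_nonneg _) (Real.abs_sin_le_one a)).trans hs'
  rw [Real.cos_add]
  linarith

/-- This is the first-order Taylor term of the potential, up to a factor. The `x v` half vanishes
vertex by vertex, and exchanging the ends of each edge reduces the `x u` half to it. -/
lemma sum_sin_mul_sub_eq_zero {θ : V → ℝ} (h : IsKuramotoEquilibrium G θ) (x : V → ℝ) :
    ∑ v, ∑ u ∈ G.neighborFinset v, Real.sin (θ u - θ v) * (x u - x v) = 0 := by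
  have h1 : ∑ v, ∑ u ∈ G.neighborFinset v, Real.sin (θ u - θ v) * x v = 0 := by
    refine Finset.sum_eq_zero fun v _ => ?_
    rw [← Finset.sum_mul, h v, zero_mul]
  have h2 : ∑ v, ∑ u ∈ G.neighborFinset v, Real.sin (θ u - θ v) * x u = 0 := by
    rw [sum_neighborFinset_comm, ← neg_eq_zero, ← h1, ← Finset.sum_neg_distrib]
    refine Finset.sum_congr rfl fun v _ => ?_
    rw [← Finset.sum_neg_distrib]
    refine Finset.sum_congr rfl fun u _ => ?_
    rw [← neg_sub (θ u), Real.sin_neg]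
    ring
  simp only [mul_sub, Finset.sum_sub_distrib]
  rw [h1, h2, sub_zero]

/-- Lower bound for the potential energy near an equilibrium. -/
lemma kuramotoPotential_add_ge {θ : V → ℝ} (h : IsKuramotoEquilibrium G θ) (x : V → ℝ)
    (hx : ‖x‖ ≤ 1 / 2) :
    kuramotoPotential G θ + hessianForm G θ x / 4 - 4 * (Fintype.card V : ℝ) ^ 2 * ‖x‖ ^ 3 ≤
      kuramotoPotential G (θ + x) := by
  have hd : ∀ v u, |x u - x v| ≤ 2 * ‖x‖ := fun v u => by
    have h1 := norm_le_pi_norm x u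
    have h2 := norm_le_pi_norm x v
    rw [Real.norm_eq_abs] at h1 h2
    have := abs_sub (x u) (x v)
    linarith
  have key : ∀ v u, (1 - Real.cos (θ u - θ v)) + Real.sin (θ u - θ v) * (x u - x v) +
      Real.cos (θ v - θ u) * (x v - x u) ^ 2 / 2 - 8 * ‖x‖ ^ 3 ≤
      1 - Real.cos ((θ + x) u - (θ + x) v) := fun v u => by
    have h1 := cos_add_le (θ u - θ v) (x u - x v) ((hd v u).trans (by linarith))
    have h2 : |x u - x v| ^ 3 ≤ (2 * ‖x‖) ^ 3 := pow_le_pow_left₀ (abs_nonneg _) (hd v u) 3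
    have h3 : (θ + x) u - (θ + x) v = θ u - θ v + (x u - x v) := by
      simp only [Pi.add_apply]; ring
    have h4 : Real.cos (θ v - θ u) = Real.cos (θ u - θ v) := by
      rw [← Real.cos_neg, neg_sub]
    have h5 : (x v - x u) ^ 2 = (x u - x v) ^ 2 := by ring
    rw [h3, h4, h5]
    linarith
  have hsum := Finset.sum_le_sum fun v (_ : v ∈ Finset.univ) =>
    Finset.sum_le_sum fun u (_ : u ∈ G.neighborFinset v) => key v u
  simp only [Finset.sum_add_distrib, Finset.sum_sub_distrib, ← Finset.sum_div] at hsum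
  have hlin := sum_sin_mul_sub_eq_zero G h x
  -- The 8 is the cube of the 2 in `hd`. The factor 1/2 in the potential halves it to 4, and
  -- together with the Taylor 1/2 it gives the quarter of the Hessian form.
  have herr : ∑ v : V, ∑ u ∈ G.neighborFinset v, 8 * ‖x‖ ^ 3 ≤
      8 * (Fintype.card V : ℝ) ^ 2 * ‖x‖ ^ 3 := by
    calc _ ≤ ∑ v : V, (Fintype.card V : ℝ) * (8 * ‖x‖ ^ 3) := by
          refine Finset.sum_le_sum fun v _ => ?_
          rw [Finset.sum_const, nsmul_eq_mul]
          refine mul_le_mul_of_nonneg_right ?_ (by positivity)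
          exact_mod_cast Finset.card_le_univ _
      _ = _ := by
          rw [Finset.sum_const, nsmul_eq_mul, Finset.card_univ]
          ring
  simp only [kuramotoPotential, hessianForm, Finset.sum_sub_distrib]
  linarith

/-- Removing the mean. -/
noncomputable def centered (x : V → ℝ) : V → ℝ := fun v => x v - (∑ u, x u) / Fintype.card V

lemma sum_centered [Nonempty V] (x : V → ℝ) : ∑ v, centered x v = 0 := by
  have : (Fintype.card V : ℝ) ≠ 0 := by simp
  simp only [centered, Finset.sum_sub_distrib, Finset.sum_const, nsmul_eq_mul, Finset.card_univ]
  field_simp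
  ring

lemma continuous_centered : Continuous (centered : (V → ℝ) → V → ℝ) := by
  unfold centered
  fun_prop

/-- The potential sees only phase differences, so the neutral direction (1, …, 1) can be projected
away. -/
lemma kuramotoPotential_add_centered (θ η : V → ℝ) :
    kuramotoPotential G (θ + centered (η - θ)) = kuramotoPotential G η := by
  simp only [kuramotoPotential, centered, Pi.add_apply, Pi.sub_apply]
  refine congrArg _ (Finset.sum_congr rfl fun v _ => Finset.sum_congr rfl fun u _ => ?_)
  congr 2
  ring

/-- The potential energy decreases along orbits. -/
lemma IsKuramotoSolution.antitone_potential {θ : ℝ → V → ℝ} (h : IsKuramotoSolution G θ) :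
    Antitone fun t => kuramotoPotential G (θ t) := by
  have hd : ∀ t, HasDerivAt (fun t => kuramotoPotential G (θ t))
      (-∑ v, kuramotoField G (θ t) v ^ 2) t := fun t => by
    refine ((hasFDerivAt_kuramotoPotential G (θ t)).comp_hasDerivAt t (h t)).congr_deriv ?_
    simp [sum_apply, sq]
  refine antitone_of_deriv_nonpos (fun t => (hd t).differentiableAt) fun t => ?_
  rw [(hd t).deriv, neg_nonpos]
  exact Finset.sum_nonneg fun v _ => sq_nonneg _

/-- Orbits that start close to an equilibrium with positive definite Hessian form remain close
to it, up to a translation. -/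
lemma exists_open_forall_norm_centered_lt [Nonempty V] {θ : V → ℝ}
    (h : IsKuramotoEquilibrium G θ)
    (hpos : ∀ x : V → ℝ, x ≠ 0 → ∑ v, x v = 0 → 0 < hessianForm G θ x) {ε : ℝ} (hε : 0 < ε) :
    ∃ W : Set (V → ℝ), IsOpen W ∧ θ ∈ W ∧ ∀ η : ℝ → V → ℝ, IsKuramotoSolution G η → η 0 ∈ W →
      ∀ t, 0 ≤ t → ‖centered (η t - θ)‖ < ε := by
  obtain ⟨l, hl, hbound⟩ := exists_mul_norm_sq_le_hessianForm G hpos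
  set N : ℝ := (Fintype.card V : ℝ) ^ 2 with hN
  have hNpos : 0 < N := by positivity
  obtain ⟨r, hr0, hrε, hr2, hrl⟩ : ∃ r : ℝ, 0 < r ∧ r ≤ ε ∧ r ≤ 1 / 2 ∧ 4 * N * r < l / 4 := by
    refine ⟨min ε (min (1 / 2) (l / (32 * N))), by positivity, min_le_left _ _,
      (min_le_right _ _).trans (min_le_left _ _), ?_⟩
    have : min ε (min (1 / 2) (l / (32 * N))) ≤ l / (32 * N) :=
      (min_le_right _ _).trans (min_le_right _ _)
    rw [le_div_iff₀ (by positivity)] at this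
    nlinarith
  -- A lower bound for the potential on the barrier `‖centered (η - θ)‖ = r`; the choice of `r` puts
  -- it strictly above the value at `θ`.
  set m := kuramotoPotential G θ + (l / 4 - 4 * N * r) * r ^ 2 with hm
  have hcpot : Continuous (kuramotoPotential G) :=
    continuous_iff_continuousAt.mpr fun η => (hasFDerivAt_kuramotoPotential G η).continuousAt
  have hcn : Continuous fun η : V → ℝ => ‖centered (η - θ)‖ :=
    (continuous_centered.comp (continuous_id.sub continuous_const)).norm
  refine ⟨{η | ‖centered (η - θ)‖ < r} ∩ {η | kuramotoPotential G η < m},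
    (isOpen_lt hcn continuous_const).inter (isOpen_lt hcpot continuous_const), ⟨?_, ?_⟩, ?_⟩
  · have : centered (θ - θ) = 0 := by ext v; simp [centered]
    rwa [Set.mem_ofPred_eq, this, norm_zero]
  · have : 0 < (l / 4 - 4 * N * r) * r ^ 2 := mul_pos (by linarith) (by positivity)
    simpa [hm] using this
  · rintro η hη ⟨h1, h2⟩ t ht
    refine lt_of_lt_of_le ?_ hrε
    -- An escaping orbit would cross the barrier by the intermediate value theorem, where its energy
    -- is at least `m`; but it starts below `m` and energy never increases.
    by_contra! hge
    have hcη : Continuous η := continuous_iff_continuousAt.mpr fun t => (hη t).continuousAt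
    obtain ⟨s, hs, hsr⟩ := intermediate_value_Icc ht (hcn.comp hcη).continuousOn
      ⟨le_of_lt h1, hge⟩
    simp only [Function.comp_apply] at hsr
    have h3 := hη.antitone_potential G hs.1
    have h4 := kuramotoPotential_add_ge G h (centered (η s - θ)) (hsr.le.trans hr2)
    have h5 := hbound (centered (η s - θ)) (sum_centered _)
    rw [kuramotoPotential_add_centered, hsr] at h4
    rw [hsr] at h5
    have h2' : kuramotoPotential G (η 0) < m := h2
    simp only at h3
    nlinarith

lemma TendsToConsensus.tendsto_cos_sub {V : Type*} {θ : ℝ → V → ℝ} (h : TendsToConsensus θ) (u v : V) :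
    Tendsto (fun t => Real.cos (θ t u - θ t v)) atTop (𝓝 1) := by
  obtain ⟨c, hc⟩ := h
  have h1 := (Real.Angle.continuous_cos.tendsto _).comp ((hc u).sub (hc v))
  simp only [sub_self, Real.Angle.cos_zero] at h1
  refine h1.congr fun t => ?_
  simp only [Function.comp_apply, ← Real.Angle.coe_sub, Real.Angle.cos_coe]

lemma exists_cos_lt_one_of_not_isConsensus {V : Type*} [Nonempty V] {θ : V → ℝ} (h : ¬ IsConsensus θ) :
    ∃ u v, Real.cos (θ u - θ v) < 1 := by
  by_contra! hcon
  obtain ⟨w⟩ := ‹Nonempty V›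
  refine h ⟨θ w, fun v => ?_⟩
  have h1 := le_antisymm (Real.cos_le_one _) (hcon v w)
  obtain ⟨n, hn⟩ := (Real.cos_eq_one_iff _).mp h1
  rw [Real.Angle.angle_eq_iff_two_pi_dvd_sub]
  exact ⟨n, by rw [← hn]; ring⟩

/-- A non-consensus equilibrium with positive definite Hessian form prevents synchronization. -/
theorem not_synchronizes_of_hessianForm_pos {θ : V → ℝ} [Nonempty V]
    (h : IsKuramotoEquilibrium G θ)
    (hpos : ∀ x : V → ℝ, x ≠ 0 → ∑ v, x v = 0 → 0 < hessianForm G θ x)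
    (hcons : ¬ IsConsensus θ) : ¬ Synchronizes G := by
  intro hsync
  obtain ⟨u, v, huv⟩ := exists_cos_lt_one_of_not_isConsensus hcons
  obtain ⟨b, hb, hb1⟩ := exists_between huv
  have hnear : ∀ᶠ s : ℝ in 𝓝 0, Real.cos (θ u - θ v + s) < b := by
    have : Continuous fun s : ℝ => Real.cos (θ u - θ v + s) := by fun_prop
    refine this.continuousAt.eventually_lt continuousAt_const ?_
    simpa using hb
  obtain ⟨ε, hε, hball⟩ := Metric.eventually_nhds_iff.mp hnear
  obtain ⟨W, hW, hθW, hstay⟩ := exists_open_forall_norm_centered_lt G h hpos (half_pos hε)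
  -- A nonempty open set has positive measure, so some orbit starting in `W` must tend to consensus.
  have hfreq : ∃ᵐ x : V → ℝ, x ∈ W := by
    rw [frequently_ae_mem_iff]
    exact (hW.measure_pos volume ⟨θ, hθW⟩).ne'
  obtain ⟨x, hxW, η, hη, rfl, hlim⟩ := (hfreq.and_eventually hsync).exists
  have h1 : 1 ≤ b := by
    refine le_of_tendsto (hlim.tendsto_cos_sub u v) ?_
    filter_upwards [eventually_ge_atTop 0] with t ht
    have h2 := hstay η hη hxW t ht
    have hu := (norm_le_pi_norm (centered (η t - θ)) u).trans_lt h2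
    have hv := (norm_le_pi_norm (centered (η t - θ)) v).trans_lt h2
    have h3 := hball (y := centered (η t - θ) u - centered (η t - θ) v) (by
      rw [dist_zero_right]
      exact (norm_sub_le _ _).trans_lt (by linarith))
    refine le_of_lt (lt_of_eq_of_lt ?_ h3)
    congr 1
    simp only [centered, Pi.sub_apply]
    ring
  linarith

end Stability

/-! ### Adjacency and neighbour sums in the spun graph. -/

section SpinG

/-- The size `⌈k/2⌉ - 1` of the blocks over `E_d`. -/
noncomputable def blockSize (k : ℕ) : ℕ := ⌈(k : ℝ) / 2⌉₊ - 1

/-- For k ≥ 1 the ceiling is positive, so the truncated subtraction loses nothing. -/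
lemma blockSize_add_one (k : ℕ) [NeZero k] : blockSize k + 1 = ⌈(k : ℝ) / 2⌉₊ := by
  have : 0 < ⌈(k : ℝ) / 2⌉₊ := Nat.ceil_pos.mpr (by have := NeZero.pos k; positivity)
  unfold blockSize
  omega

lemma two_mul_blockSize_lt (k : ℕ) [NeZero k] : 2 * blockSize k < k := by
  have h1 := blockSize_add_one k
  have h2 := Nat.ceil_lt_add_one (show 0 ≤ (k : ℝ) / 2 by positivity)
  rw [← h1] at h2
  push_cast at h2
  have : (2 * blockSize k : ℝ) < k := by linarith
  exact_mod_cast this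

/-- Offsets below k exhaust ℤ_k; hence an edge of weight k becomes a complete bipartite graph
between fibres. -/
lemma exists_lt_eq_add {k : ℕ} [NeZero k] (i j : ZMod k) : ∃ h : ℕ, h < k ∧ j = i + (h : ZMod k) :=
  ⟨(j - i).val, ZMod.val_lt _, by rw [ZMod.natCast_zmod_val]; ring⟩

lemma weightedG_weight_of_near (k d : ℕ) {u v : ZMod 8}
    (h : v = u + 1 ∨ v = u - 1 ∨ v = u + 2 ∨ v = u - 2) :
    (weightedG k k k d).weight s(u, v) = k := by
  have key : ∀ u v : ZMod 8, (v = u + 1 ∨ v = u - 1 ∨ v = u + 2 ∨ v = u - 2) →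
      (arcA u v ∨ arcA v u) ∨ (arcB u v ∨ arcB v u) ∨ (arcC u v ∨ arcC v u) := by decide
  have h' := key u v h
  simp only [weightedG, Sym2.lift_mk]
  by_cases hA : arcA u v ∨ arcA v u
  · rw [if_pos hA]
  by_cases hB : arcB u v ∨ arcB v u
  · rw [if_neg hA, if_pos hB]
  rw [if_neg hA, if_neg hB, if_pos ((h'.resolve_left hA).resolve_left hB)]

lemma weightedG_weight_of_far (k d : ℕ) {u v : ZMod 8} (h : arcD u v ∨ arcD v u) :
    (weightedG k k k d).weight s(u, v) = d := by
  have key : ∀ u v : ZMod 8, (arcD u v ∨ arcD v u) →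
      ¬ (arcA u v ∨ arcA v u) ∧ ¬ (arcB u v ∨ arcB v u) ∧ ¬ (arcC u v ∨ arcC v u) := by decide
  obtain ⟨hA, hB, hC⟩ := key u v h
  simp only [weightedG, Sym2.lift_mk]
  rw [if_neg hA, if_neg hB, if_neg hC, if_pos h]

lemma spinG_adj_iff (k : ℕ) (u v : ZMod 8) (i j : ZMod k) :
    (spinG k).Adj (u, i) (v, j) ↔ (u = v ∧ i ≠ j) ∨
      ((weightedG k k k (blockSize k)).arc u v ∧
        ∃ h : ℕ, h < (weightedG k k k (blockSize k)).weight s(u, v) ∧ j = i + (h : ZMod k)) ∨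
      ((weightedG k k k (blockSize k)).arc v u ∧
        ∃ h : ℕ, h < (weightedG k k k (blockSize k)).weight s(u, v) ∧ i = j + (h : ZMod k)) := by
  have hloop : ∀ u : ZMod 8, ¬ (weightedG k k k (blockSize k)).arc u u :=
    fun u h => (weightedG k k k (blockSize k)).arc_asymm u u h h
  have hs : spinG k = spinning (weightedG k k k (blockSize k)) k := rfl
  rw [hs, spinning, SimpleGraph.fromRel_adj, Sym2.eq_swap (a := v)]
  simp only [ne_eq, Prod.mk.injEq]
  constructor
  · rintro ⟨-, (h | h) | (h | h)⟩
    · exact Or.inl h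
    · exact Or.inr (Or.inl h)
    · exact Or.inl ⟨h.1.symm, fun e => h.2 e.symm⟩
    · exact Or.inr (Or.inr h)
  · rintro (h | h | h)
    · exact ⟨fun e => h.2 e.2, Or.inl (Or.inl h)⟩
    · exact ⟨fun e => hloop u (by simpa [← e.1] using h.1), Or.inl (Or.inr h)⟩
    · exact ⟨fun e => hloop u (by simpa [← e.1] using h.1), Or.inr (Or.inr h)⟩

lemma weightedG_arc_iff (a b c d : ℕ) (u v : ZMod 8) :
    (weightedG a b c d).arc u v ↔ arcA u v ∨ arcB u v ∨ arcC u v ∨ arcD u v := Iff.rfl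

lemma spinG_adj_self (k : ℕ) (u : ZMod 8) (i j : ZMod k) :
    (spinG k).Adj (u, i) (u, j) ↔ j ≠ i := by
  have hloop : ¬ (weightedG k k k (blockSize k)).arc u u :=
    fun h => (weightedG k k k (blockSize k)).arc_asymm u u h h
  simp [spinG_adj_iff, hloop, eq_comm]

lemma spinG_adj_of_near (k : ℕ) [NeZero k] {u v : ZMod 8}
    (h : v = u + 1 ∨ v = u - 1 ∨ v = u + 2 ∨ v = u - 2) (i j : ZMod k) :
    (spinG k).Adj (u, i) (v, j) := by
  have key : ∀ u v : ZMod 8, (v = u + 1 ∨ v = u - 1 ∨ v = u + 2 ∨ v = u - 2) →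
      (arcA u v ∨ arcB u v ∨ arcC u v ∨ arcD u v) ∨
      (arcA v u ∨ arcB v u ∨ arcC v u ∨ arcD v u) := by decide
  rw [spinG_adj_iff, weightedG_weight_of_near _ _ h]
  rcases key u v h with h' | h'
  · exact Or.inr (Or.inl ⟨h', exists_lt_eq_add i j⟩)
  · exact Or.inr (Or.inr ⟨h', exists_lt_eq_add j i⟩)

lemma spinG_adj_of_arcD (k : ℕ) {u v : ZMod 8} (h : arcD u v) (i j : ZMod k) :
    (spinG k).Adj (u, i) (v, j) ↔ ∃ h : ℕ, h < blockSize k ∧ j = i + (h : ZMod k) := by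
  have key : ∀ u v : ZMod 8, arcD u v →
      u ≠ v ∧ ¬ (arcA v u ∨ arcB v u ∨ arcC v u ∨ arcD v u) := by decide
  obtain ⟨h1, h2⟩ := key u v h
  rw [spinG_adj_iff, weightedG_weight_of_far _ _ (Or.inl h), weightedG_arc_iff, weightedG_arc_iff]
  simp [h1, h2, h]

lemma not_spinG_adj (k : ℕ) {u v : ZMod 8} (h : u ≠ v)
    (hn : ¬ (v = u + 1 ∨ v = u - 1 ∨ v = u + 2 ∨ v = u - 2)) (h1 : ¬ arcD u v) (h2 : ¬ arcD v u)
    (i j : ZMod k) : ¬ (spinG k).Adj (u, i) (v, j) := by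
  have key : ∀ u v : ZMod 8, ¬ (v = u + 1 ∨ v = u - 1 ∨ v = u + 2 ∨ v = u - 2) →
      ¬ arcD u v → ¬ arcD v u → ¬ (arcA u v ∨ arcB u v ∨ arcC u v ∨ arcD u v) ∧
      ¬ (arcA v u ∨ arcB v u ∨ arcC v u ∨ arcD v u) := by decide
  obtain ⟨h3, h4⟩ := key u v hn h1 h2
  rw [spinG_adj_iff, weightedG_arc_iff, weightedG_arc_iff]
  simp [h, h3, h4]

/-- Since d ≤ k, the offsets below d are distinct residues, so no neighbour is counted twice. -/
lemma sum_filter_natCast_add {k d : ℕ} [NeZero k] (hd : d ≤ k) (i : ZMod k) (f : ZMod k → ℝ)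
    [DecidablePred fun j : ZMod k => ∃ h : ℕ, h < d ∧ j = i + (h : ZMod k)] :
    ∑ j with (∃ h : ℕ, h < d ∧ j = i + (h : ZMod k)), f j =
      ∑ h ∈ Finset.range d, f (i + (h : ZMod k)) := by
  symm
  refine Finset.sum_bij (fun h _ => i + (h : ZMod k)) ?_ ?_ ?_ fun _ _ => rfl
  · intro h hh
    simpa using ⟨h, Finset.mem_range.mp hh, rfl⟩
  · intro a ha b hb hab
    have h1 := add_left_cancel hab
    rw [ZMod.natCast_eq_natCast_iff'] at h1
    rwa [Nat.mod_eq_of_lt ((Finset.mem_range.mp ha).trans_le hd),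
      Nat.mod_eq_of_lt ((Finset.mem_range.mp hb).trans_le hd)] at h1
  · intro j hj
    obtain ⟨h, hh, rfl⟩ := (Finset.mem_filter.mp hj).2
    exact ⟨h, Finset.mem_range.mpr hh, rfl⟩

lemma sum_filter_natCast_sub {k d : ℕ} [NeZero k] (hd : d ≤ k) (i : ZMod k) (f : ZMod k → ℝ)
    [DecidablePred fun j : ZMod k => ∃ h : ℕ, h < d ∧ i = j + (h : ZMod k)] :
    ∑ j with (∃ h : ℕ, h < d ∧ i = j + (h : ZMod k)), f j =
      ∑ h ∈ Finset.range d, f (i - (h : ZMod k)) := by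
  symm
  refine Finset.sum_bij (fun h _ => i - (h : ZMod k)) ?_ ?_ ?_ fun _ _ => rfl
  · intro h hh
    simpa using ⟨h, Finset.mem_range.mp hh, by ring⟩
  · intro a ha b hb hab
    have h1 : (a : ZMod k) = b := sub_right_injective hab
    rw [ZMod.natCast_eq_natCast_iff'] at h1
    rwa [Nat.mod_eq_of_lt ((Finset.mem_range.mp ha).trans_le hd),
      Nat.mod_eq_of_lt ((Finset.mem_range.mp hb).trans_le hd)] at h1
  · intro j hj
    obtain ⟨h, hh, rfl⟩ := (Finset.mem_filter.mp hj).2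
    exact ⟨h, Finset.mem_range.mpr hh, by ring⟩

/-- A sum over the neighbours of a vertex of `spinG k`, fibre by fibre. -/
lemma sum_neighborFinset_spinG (k : ℕ) [NeZero k] (u : ZMod 8) (i : ZMod k)
    (f : ZMod 8 × ZMod k → ℝ) :
    ∑ w ∈ (spinG k).neighborFinset (u, i), f w =
      (∑ j, f (u, j) - f (u, i)) + ∑ j, f (u + 1, j) + ∑ j, f (u - 1, j) +
      ∑ j, f (u + 2, j) + ∑ j, f (u - 2, j) +
      if arcD u (u + 5) then ∑ h ∈ Finset.range (blockSize k), f (u + 5, i + (h : ZMod k))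
      else ∑ h ∈ Finset.range (blockSize k), f (u + 3, i - (h : ZMod k)) := by
  classical
  have hd : blockSize k ≤ k := by have := two_mul_blockSize_lt k; omega
  have key : ∀ v, ∑ j, (if (spinG k).Adj (u, i) (v, j) then f (v, j) else 0) =
      (if v = u then ∑ j, f (u, j) - f (u, i) else 0) +
      (if v = u + 1 then ∑ j, f (v, j) else 0) + (if v = u - 1 then ∑ j, f (v, j) else 0) +
      (if v = u + 2 then ∑ j, f (v, j) else 0) + (if v = u - 2 then ∑ j, f (v, j) else 0) +
      ((if v = u + 5 then if arcD u v then
        ∑ h ∈ Finset.range (blockSize k), f (v, i + (h : ZMod k)) else 0 else 0) +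
      (if v = u + 3 then if arcD v u then
        ∑ h ∈ Finset.range (blockSize k), f (v, i - (h : ZMod k)) else 0 else 0)) := by
    intro v
    have hcases : ∀ u v : ZMod 8, v = u ∨ (v = u + 1 ∨ v = u - 1 ∨ v = u + 2 ∨ v = u - 2) ∨
        arcD u v ∨ arcD v u ∨ (u ≠ v ∧ ¬ (v = u + 1 ∨ v = u - 1 ∨ v = u + 2 ∨ v = u - 2) ∧
          ¬ arcD u v ∧ ¬ arcD v u) := by decide
    rcases hcases u v with rfl | h | h | h | ⟨h0, h1, h2, h3⟩
    · have e : ∀ v : ZMod 8, v ≠ v + 1 ∧ v ≠ v - 1 ∧ v ≠ v + 2 ∧ v ≠ v - 2 ∧ v ≠ v + 5 ∧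
          v ≠ v + 3 := by decide
      obtain ⟨e1, e2, e3, e4, e5, e6⟩ := e v
      simp only [spinG_adj_self, if_neg e1, if_neg e2, if_neg e3, if_neg e4, if_neg e5,
        if_neg e6, if_true, add_zero, ite_not]
      rw [← Finset.sum_erase_eq_sub (Finset.mem_univ i), ← Finset.filter_ne', Finset.sum_filter]
      simp only [ite_not, ne_eq]
    · have e : ∀ u v : ZMod 8, (v = u + 1 ∨ v = u - 1 ∨ v = u + 2 ∨ v = u - 2) → v ≠ u ∧
          v ≠ u + 5 ∧ v ≠ u + 3 := by decide
      obtain ⟨e1, e2, e3⟩ := e u v h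
      simp only [spinG_adj_of_near k h, if_true, if_neg e1, if_neg e2, if_neg e3, add_zero,
        zero_add]
      have f : ∀ u : ZMod 8, u + 1 ≠ u - 1 ∧ u + 1 ≠ u + 2 ∧ u + 1 ≠ u - 2 ∧ u - 1 ≠ u + 2 ∧
        u - 1 ≠ u - 2 ∧ u + 2 ≠ u - 2 := by decide
      obtain ⟨f1, f2, f3, f4, f5, f6⟩ := f u
      rcases h with rfl | rfl | rfl | rfl
      · simp only [if_true, if_neg f1, if_neg f2, if_neg f3, add_zero]
      · simp only [if_true, if_neg f1.symm, if_neg f4, if_neg f5, add_zero, zero_add]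
      · simp only [if_true, if_neg f2.symm, if_neg f4.symm, if_neg f6, add_zero, zero_add]
      · simp only [if_true, if_neg f3.symm, if_neg f5.symm, if_neg f6.symm, zero_add]
    · have e : ∀ u v : ZMod 8, arcD u v → v ≠ u ∧ v ≠ u + 1 ∧ v ≠ u - 1 ∧ v ≠ u + 2 ∧ v ≠ u - 2 ∧
          v = u + 5 ∧ v ≠ u + 3 := by decide
      obtain ⟨e1, e2, e3, e4, e5, e6, e7⟩ := e u v h
      simp only [spinG_adj_of_arcD k h, if_neg e1, if_neg e2, if_neg e3, if_neg e4, if_neg e5,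
        if_pos e6, if_neg e7, if_pos h, add_zero, zero_add]
      rw [← sum_filter_natCast_add hd i fun j => f (v, j), Finset.sum_filter]
    · have e : ∀ u v : ZMod 8, arcD v u → v ≠ u ∧ v ≠ u + 1 ∧ v ≠ u - 1 ∧ v ≠ u + 2 ∧ v ≠ u - 2 ∧
          v ≠ u + 5 ∧ v = u + 3 := by decide
      obtain ⟨e1, e2, e3, e4, e5, e6, e7⟩ := e u v h
      simp only [(spinG k).adj_comm (u, i), spinG_adj_of_arcD k h, if_neg e1, if_neg e2,
        if_neg e3, if_neg e4, if_neg e5, if_neg e6, if_pos e7, if_pos h, zero_add]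
      rw [← sum_filter_natCast_sub hd i fun j => f (v, j), Finset.sum_filter]
    · simp only [not_spinG_adj k h0 h1 h2 h3, if_false, if_neg h0.symm, if_neg h2, if_neg h3]
      simp only [not_or] at h1
      obtain ⟨e1, e2, e3, e4⟩ := h1
      simp [if_neg e1, if_neg e2, if_neg e3, if_neg e4]
  rw [SimpleGraph.neighborFinset_eq_filter, Finset.sum_filter, Fintype.sum_prod_type]
  simp only [key, Finset.sum_add_distrib, Finset.sum_ite_eq', Finset.mem_univ, if_true]
  -- `arcD u (u + 5)` encodes that `u` is even. An even vertex has only an outgoing edge of `E_d`,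
  -- an odd one only an incoming edge, from `u + 3`.
  have hD : arcD u (u + 5) ↔ ¬ arcD (u + 3) u := by
    clear key; revert u; decide
  by_cases h : arcD u (u + 5)
  · simp [h, hD.mp h]
  · have h' : arcD (u + 3) u := by tauto
    simp [h, h']

end SpinG

/-! ### Means and deviations on fibres. -/

section FibreStatistics

variable {k : ℕ} [NeZero k]

/-- The mean of a function on a fibre. -/
noncomputable def fibreMean (a : ZMod k → ℝ) : ℝ := (∑ i, a i) / k

/-- The sum of squared deviations from the mean on a fibre. -/
noncomputable def fibreDev (a : ZMod k → ℝ) : ℝ := ∑ i, (a i - fibreMean a) ^ 2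

lemma fibreDev_nonneg (a : ZMod k → ℝ) : 0 ≤ fibreDev a :=
  Finset.sum_nonneg fun _ _ => sq_nonneg _

lemma sum_eq_mul_fibreMean (a : ZMod k → ℝ) : ∑ i, a i = k * fibreMean a := by
  have : (k : ℝ) ≠ 0 := NeZero.ne _
  unfold fibreMean
  field_simp

lemma sum_sub_fibreMean (a : ZMod k → ℝ) : ∑ i, (a i - fibreMean a) = 0 := by
  rw [Finset.sum_sub_distrib, sum_eq_mul_fibreMean]
  simp [ZMod.card]

lemma eq_fibreMean_of_fibreDev_eq_zero {a : ZMod k → ℝ} (h : fibreDev a = 0) (i : ZMod k) :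
    a i = fibreMean a := by
  have h1 := (Finset.sum_eq_zero_iff_of_nonneg fun i _ => sq_nonneg (a i - fibreMean a)).mp h i
    (Finset.mem_univ i)
  exact sub_eq_zero.mp (pow_eq_zero_iff (two_ne_zero) |>.mp h1)

lemma exists_deviation (a : ZMod k → ℝ) :
    ∃ α : ZMod k → ℝ, (∀ i, a i = α i + fibreMean a) ∧ ∑ i, α i = 0 ∧ fibreDev a = ∑ i, α i ^ 2 :=
  ⟨fun i => a i - fibreMean a, fun i => by ring, sum_sub_fibreMean a, rfl⟩

/-- Deviations sum to zero, so in a complete bipartite sum every cross term cancels and the identity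
is exact. -/
lemma sum_sum_sq_sub (a b : ZMod k → ℝ) :
    ∑ i, ∑ j, (a i - b j) ^ 2 =
      k * fibreDev a + k * fibreDev b + k ^ 2 * (fibreMean a - fibreMean b) ^ 2 := by
  obtain ⟨α, ha, hα, hDa⟩ := exists_deviation a
  obtain ⟨β, hb, hβ, hDb⟩ := exists_deviation b
  rw [hDa, hDb]
  generalize fibreMean a = p at *
  generalize fibreMean b = q at *
  have e : ∀ i j, (a i - b j) ^ 2 = α i ^ 2 + β j ^ 2 + (p - q) ^ 2 + 2 * (p - q) * α i -
      2 * (p - q) * β j - 2 * α i * β j := fun i j => by rw [ha, hb]; ring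
  simp only [e, Finset.sum_add_distrib, Finset.sum_sub_distrib, ← Finset.mul_sum, hα, hβ,
    Finset.sum_const, Finset.card_univ, ZMod.card, nsmul_eq_mul, mul_zero]
  ring

/-- A shift permutes the fibre, so the terms mixing means and deviations still cancel. The product
of deviations survives and is absorbed by 2|αβ| ≤ α² + β². An upper bound suffices because these
edges have negative coefficients. -/
lemma sum_sq_sub_shift_le (a b : ZMod k → ℝ) (c : ZMod k) :
    ∑ i, (a i - b (i + c)) ^ 2 ≤
      k * (fibreMean a - fibreMean b) ^ 2 + 2 * fibreDev a + 2 * fibreDev b := by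
  obtain ⟨α, ha, hα, hDa⟩ := exists_deviation a
  obtain ⟨β, hb, hβ, hDb⟩ := exists_deviation b
  rw [hDa, hDb]
  generalize fibreMean a = p at *
  generalize fibreMean b = q at *
  have hs : ∀ g : ZMod k → ℝ, ∑ i, g (i + c) = ∑ i, g i :=
    fun g => Equiv.sum_comp (Equiv.addRight c) g
  have h1 : ∑ i, β (i + c) = 0 := (hs β).trans hβ
  have h2 : ∑ i, β (i + c) ^ 2 = ∑ i, β i ^ 2 := hs fun i => β i ^ 2
  have e : ∀ i, (a i - b (i + c)) ^ 2 ≤ (p - q) ^ 2 + 2 * α i ^ 2 + 2 * β (i + c) ^ 2 +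
      2 * (p - q) * α i - 2 * (p - q) * β (i + c) := fun i => by
    rw [ha, hb]
    nlinarith [sq_nonneg (α i + β (i + c))]
  refine (Finset.sum_le_sum fun i _ => e i).trans (le_of_eq ?_)
  simp only [Finset.sum_add_distrib, Finset.sum_sub_distrib, ← Finset.mul_sum, hα, h1, h2,
    Finset.sum_const, Finset.card_univ, ZMod.card, nsmul_eq_mul, mul_zero]
  ring

lemma sum_range_sq_sub_le (a b : ZMod k → ℝ) (d : ℕ) (c : ℕ → ZMod k) :
    ∑ i, ∑ h ∈ Finset.range d, (a i - b (i + c h)) ^ 2 ≤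
      d * (k * (fibreMean a - fibreMean b) ^ 2 + 2 * fibreDev a + 2 * fibreDev b) := by
  rw [Finset.sum_comm]
  refine (Finset.sum_le_sum fun h _ => sum_sq_sub_shift_le a b (c h)).trans (le_of_eq ?_)
  rw [Finset.sum_const, Finset.card_range, nsmul_eq_mul]

end FibreStatistics

/-! ### The quadratic form on the eight fibre means. -/

/-- The quadratic form on the fibre means. -/
noncomputable def ringForm (K D m0 m1 m2 m3 m4 m5 m6 m7 : ℝ) : ℝ :=
  K * (K - D) * ((m0 - m1) ^ 2 + (m2 - m3) ^ 2 + (m4 - m5) ^ 2 + (m6 - m7) ^ 2) +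
    K ^ 2 * ((m1 - m2) ^ 2 + (m3 - m4) ^ 2 + (m5 - m6) ^ 2 + (m7 - m0) ^ 2) -
    D * (K - D) * ((m0 - m5) ^ 2 + (m2 - m7) ^ 2 + (m4 - m1) ^ 2 + (m6 - m3) ^ 2)

/-- Antipodal sums m_i + m_{i+4} and differences q_i = m_i - m_{i+4} decouple. On the sums the form
is that of a 4-cycle with positive weights (K - D)² and K². On the differences, completing squares
in q_0 and q_2 leaves a multiple of (K - 2D)(q_1² + q_3²), the cross terms cancelling; positivity of
that remainder is what 2D < K provides. -/
lemma eq_of_ringForm_nonpos {K D : ℝ} (hD : 0 ≤ D) (hDK : 2 * D < K)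
    {m0 m1 m2 m3 m4 m5 m6 m7 : ℝ} (hF : ringForm K D m0 m1 m2 m3 m4 m5 m6 m7 ≤ 0) :
    m1 = m0 ∧ m2 = m0 ∧ m3 = m0 ∧ m4 = m0 ∧ m5 = m0 ∧ m6 = m0 ∧ m7 = m0 := by
  have hz : ∀ {c y : ℝ}, 0 < c → c * y ^ 2 ≤ 0 → y = 0 := fun {c y} hc h =>
    pow_eq_zero_iff two_ne_zero |>.mp
      (le_antisymm (nonpos_of_mul_nonpos_right h hc) (sq_nonneg y))
  have hsplit : ∀ a b c d e f g h : ℝ, 0 ≤ a → 0 ≤ b → 0 ≤ c → 0 ≤ d → 0 ≤ e → 0 ≤ f → 0 ≤ g →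
      0 ≤ h → a + b + c + d + e + f + g + h ≤ 0 →
      a ≤ 0 ∧ b ≤ 0 ∧ c ≤ 0 ∧ e ≤ 0 ∧ f ≤ 0 ∧ g ≤ 0 ∧ h ≤ 0 := by
    intros
    refine ⟨?_, ?_, ?_, ?_, ?_, ?_, ?_⟩ <;> linarith
  unfold ringForm at hF
  set E := K - D with hE
  have hEpos : 0 < E := by linarith
  have hK : 0 < K := by linarith
  set N := E ^ 2 + K ^ 2 with hN
  have hNpos : 0 < N := by positivity
  -- `N` is the coefficient of q_0² and q_2² up to a common factor; `w₁` and `w₂` collect their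
  -- cross terms with q_1 and q_3.
  set w₁ := E * (K + D) * (m1 - m5) - K ^ 2 * (m3 - m7) with hw₁
  set w₂ := E * (K + D) * (m3 - m7) + K ^ 2 * (m1 - m5) with hw₂
  have key : N * E ^ 2 * (m1 + m5 - m0 - m4) ^ 2 + N * E ^ 2 * (m3 + m7 - m2 - m6) ^ 2 +
      N * K ^ 2 * (m2 + m6 - m1 - m5) ^ 2 + N * K ^ 2 * (m0 + m4 - m3 - m7) ^ 2 +
      (N * (m0 - m4) - w₁) ^ 2 + (N * (m2 - m6) - w₂) ^ 2 +
      2 * K * E ^ 2 * (K - 2 * D) * (m1 - m5) ^ 2 +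
      2 * K * E ^ 2 * (K - 2 * D) * (m3 - m7) ^ 2 ≤ 0 := by
    have h := mul_nonpos_of_nonneg_of_nonpos (by positivity : 0 ≤ 2 * N) hF
    refine le_of_eq_of_le ?_ h
    rw [hw₁, hw₂, hN, hE]
    ring
  have hc1 : 0 < N * E ^ 2 := by positivity
  have hc2 : 0 < N * K ^ 2 := by positivity
  have hc3 : 0 < 2 * K * E ^ 2 * (K - 2 * D) := mul_pos (by positivity) (by linarith)
  have p1 := mul_nonneg hc1.le (sq_nonneg (m1 + m5 - m0 - m4))
  have p2 := mul_nonneg hc1.le (sq_nonneg (m3 + m7 - m2 - m6))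
  have p3 := mul_nonneg hc2.le (sq_nonneg (m2 + m6 - m1 - m5))
  have p4 := mul_nonneg hc2.le (sq_nonneg (m0 + m4 - m3 - m7))
  have p5 := sq_nonneg (N * (m0 - m4) - w₁)
  have p6 := sq_nonneg (N * (m2 - m6) - w₂)
  have p7 := mul_nonneg hc3.le (sq_nonneg (m1 - m5))
  have p8 := mul_nonneg hc3.le (sq_nonneg (m3 - m7))
  -- The fourth square is dropped: three edges of the 4-cycle already make all antipodal sums equal.
  obtain ⟨l1, l2, l3, l5, l6, l7, l8⟩ := hsplit _ _ _ _ _ _ _ _ p1 p2 p3 p4 p5 p6 p7 p8 key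
  have q1 := hz hc1 l1
  have q2 := hz hc1 l2
  have q3 := hz hc2 l3
  have q5 := hz one_pos ((one_mul _).trans_le l5)
  have q6 := hz one_pos ((one_mul _).trans_le l6)
  have q7 := hz hc3 l7
  have q8 := hz hc3 l8
  clear key hF p1 p2 p3 p4 p5 p6 p7 p8 l1 l2 l3 l5 l6 l7 l8
  rw [hw₁, q7, q8] at q5
  rw [hw₂, q7, q8] at q6
  have r5 : m0 - m4 = 0 := by
    have : N * (m0 - m4) = 0 := by linarith
    exact (mul_eq_zero.mp this).resolve_left hNpos.ne'
  have r6 : m2 - m6 = 0 := by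
    have : N * (m2 - m6) = 0 := by linarith
    exact (mul_eq_zero.mp this).resolve_left hNpos.ne'
  refine ⟨?_, ?_, ?_, ?_, ?_, ?_, ?_⟩ <;> linarith

/-- A lower bound for the contribution of a fibre to the Hessian form, in terms of the deviations
and means on this fibre and on those of its neighbours in `E_a`, `E_c` and `E_d`. -/
noncomputable def fibreBound (K D τ s m sa ma sc mc sd md : ℝ) : ℝ :=
  2 * K * s + (K - D) * τ * (K * s + K * sa + K ^ 2 * (m - ma) ^ 2) +
    K * τ * (K * s + K * sc + K ^ 2 * (m - mc) ^ 2) -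
    (K - D) * τ * (D * (K * (m - md) ^ 2 + 2 * s + 2 * sd))

/-- Each edge is seen from both ends, hence the factor 2. In the deviation coefficient, K - 2D shows
the loss over `E_d` absorbed by the gain over `E_a`. -/
lemma sum_fibreBound (K D τ s0 s1 s2 s3 s4 s5 s6 s7 m0 m1 m2 m3 m4 m5 m6 m7 : ℝ) :
    fibreBound K D τ s0 m0 s1 m1 s7 m7 s5 m5 + fibreBound K D τ s1 m1 s0 m0 s2 m2 s4 m4 +
    fibreBound K D τ s2 m2 s3 m3 s1 m1 s7 m7 + fibreBound K D τ s3 m3 s2 m2 s4 m4 s6 m6 +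
    fibreBound K D τ s4 m4 s5 m5 s3 m3 s1 m1 + fibreBound K D τ s5 m5 s4 m4 s6 m6 s0 m0 +
    fibreBound K D τ s6 m6 s7 m7 s5 m5 s3 m3 + fibreBound K D τ s7 m7 s6 m6 s0 m0 s2 m2 =
    2 * ((K + (K - D) * τ * (K - 2 * D) + K * τ * K) *
      (s0 + s1 + s2 + s3 + s4 + s5 + s6 + s7) +
      K * τ * ringForm K D m0 m1 m2 m3 m4 m5 m6 m7) := by
  unfold fibreBound ringForm
  ring

/-! ### The twisted equilibrium and its Hessian form. -/

section TwistedState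

/-- The angle between the phases at `0` and `1` of the twisted state. -/
noncomputable def twistAngle (k : ℕ) : ℝ := Real.arctan (k / (k - blockSize k))

/-- The phase `iπ/2` at `2i` and `iπ/2 + φ` at `2i + 1`. -/
noncomputable def twistPhase (φ : ℝ) (u : ZMod 8) : ℝ :=
  (u.val / 2 : ℕ) * (Real.pi / 2) + (u.val % 2 : ℕ) * φ

/-- Moving by 2 is a quarter turn, except that wrapping around ℤ_8 subtracts a further 2π, invisible
to sine and cosine. -/
lemma cos_sin_twistPhase (φ : ℝ) (u : ZMod 8) :
    Real.cos (twistPhase φ (u + 2)) = -Real.sin (twistPhase φ u) ∧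
    Real.sin (twistPhase φ (u + 2)) = Real.cos (twistPhase φ u) := by
  have h : ∀ u : ZMod 8, ((u + 2).val / 2 = u.val / 2 + 1 ∨
      ((u + 2).val / 2 + 4 = u.val / 2 + 1)) ∧ (u + 2).val % 2 = u.val % 2 := by decide
  obtain ⟨h1, h2⟩ := h u
  have hphase : twistPhase φ (u + 2) = twistPhase φ u + Real.pi / 2 ∨
      twistPhase φ (u + 2) = twistPhase φ u + Real.pi / 2 - 2 * Real.pi := by
    simp only [twistPhase, h2]
    rcases h1 with h1 | h1
    · left
      rw [h1]
      push_cast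
      ring
    · right
      have : (((u + 2).val / 2 : ℕ) : ℝ) = ((u.val / 2 : ℕ) : ℝ) - 3 := by
        have : (((u + 2).val / 2 : ℕ) : ℝ) + 4 = ((u.val / 2 : ℕ) : ℝ) + 1 := by exact_mod_cast h1
        linarith
      rw [this]
      ring
  rcases hphase with h | h <;> rw [h]
  · exact ⟨Real.cos_add_pi_div_two _, Real.sin_add_pi_div_two _⟩
  · rw [Real.cos_sub_two_pi, Real.sin_sub_two_pi]
    exact ⟨Real.cos_add_pi_div_two _, Real.sin_add_pi_div_two _⟩

lemma cos_sin_twistPhase_of_even (φ : ℝ) {u : ZMod 8} (hu : arcD u (u + 5)) :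
    Real.cos (twistPhase φ (u + 1)) = Real.cos (twistPhase φ u) * Real.cos φ -
      Real.sin (twistPhase φ u) * Real.sin φ ∧
    Real.sin (twistPhase φ (u + 1)) = Real.sin (twistPhase φ u) * Real.cos φ +
      Real.cos (twistPhase φ u) * Real.sin φ := by
  have h : ∀ u : ZMod 8, arcD u (u + 5) →
      (u + 1).val / 2 = u.val / 2 ∧ (u + 1).val % 2 = 1 ∧ u.val % 2 = 0 := by decide
  obtain ⟨h1, h2, h3⟩ := h u hu
  have : twistPhase φ (u + 1) = twistPhase φ u + φ := by
    simp only [twistPhase, h1, h2, h3]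
    push_cast
    ring
  rw [this]
  exact ⟨Real.cos_add _ _, Real.sin_add _ _⟩

/-- Sines and cosines of the phase differences between an even vertex and its neighbours. -/
lemma twistPhase_sub_of_even (φ : ℝ) {u : ZMod 8} (hu : arcD u (u + 5)) :
    (Real.sin (twistPhase φ (u + 1) - twistPhase φ u) = Real.sin φ ∧
      Real.cos (twistPhase φ u - twistPhase φ (u + 1)) = Real.cos φ) ∧
    (Real.sin (twistPhase φ (u - 1) - twistPhase φ u) = -Real.cos φ ∧
      Real.cos (twistPhase φ u - twistPhase φ (u - 1)) = Real.sin φ) ∧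
    (Real.sin (twistPhase φ (u + 5) - twistPhase φ u) = -Real.sin φ ∧
      Real.cos (twistPhase φ u - twistPhase φ (u + 5)) = -Real.cos φ) := by
  obtain ⟨c1, s1⟩ := cos_sin_twistPhase_of_even φ hu
  obtain ⟨c3, s3⟩ := cos_sin_twistPhase φ (u + 1)
  obtain ⟨c5, s5⟩ := cos_sin_twistPhase φ (u + 1 + 2)
  obtain ⟨c7, s7⟩ := cos_sin_twistPhase φ (u - 1)
  have e : ∀ u : ZMod 8, u + 1 + 2 + 2 = u + 5 ∧ u - 1 + 2 = u + 1 := by decide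
  rw [(e u).1] at c5 s5
  rw [(e u).2] at c7 s7
  have c7' : Real.cos (twistPhase φ (u - 1)) = Real.sin (twistPhase φ (u + 1)) := s7.symm
  have s7' : Real.sin (twistPhase φ (u - 1)) = -Real.cos (twistPhase φ (u + 1)) := by linarith
  have h := Real.sin_sq_add_cos_sq (twistPhase φ u)
  simp only [Real.sin_sub, Real.cos_sub, c5, s5, c7', s7', c3, s3, c1, s1]
  refine ⟨⟨?_, ?_⟩, ⟨?_, ?_⟩, ⟨?_, ?_⟩⟩
  · linear_combination Real.sin φ * h
  · linear_combination Real.cos φ * h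
  · linear_combination -Real.cos φ * h
  · linear_combination Real.sin φ * h
  · linear_combination -Real.sin φ * h
  · linear_combination -Real.cos φ * h

/-- Sines and cosines of the phase differences between an odd vertex and its neighbours. -/
lemma twistPhase_sub_of_odd (φ : ℝ) {u : ZMod 8} (hu : ¬ arcD u (u + 5)) :
    (Real.sin (twistPhase φ (u + 1) - twistPhase φ u) = Real.cos φ ∧
      Real.cos (twistPhase φ u - twistPhase φ (u + 1)) = Real.sin φ) ∧
    (Real.sin (twistPhase φ (u - 1) - twistPhase φ u) = -Real.sin φ ∧
      Real.cos (twistPhase φ u - twistPhase φ (u - 1)) = Real.cos φ) ∧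
    (Real.sin (twistPhase φ (u + 3) - twistPhase φ u) = Real.sin φ ∧
      Real.cos (twistPhase φ u - twistPhase φ (u + 3)) = -Real.cos φ) := by
  have e : ∀ u : ZMod 8, ¬ arcD u (u + 5) → arcD (u + 1) (u + 1 + 5) ∧ arcD (u - 1) (u - 1 + 5) ∧
      arcD (u + 3) (u + 3 + 5) ∧ u + 1 - 1 = u ∧ u - 1 + 1 = u ∧ u + 3 + 5 = u := by decide
  obtain ⟨e1, e2, e3, e4, e5, e6⟩ := e u hu
  -- The same edges seen from their even ends `u + 1`, `u - 1` and `u + 3`; reversal flips the sines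
  -- and keeps the cosines.
  have h1 := (twistPhase_sub_of_even φ e1).2.1
  have h2 := (twistPhase_sub_of_even φ e2).1
  have h3 := (twistPhase_sub_of_even φ e3).2.2
  rw [e4] at h1
  rw [e5] at h2
  rw [e6] at h3
  have hs : ∀ x y : ℝ, Real.sin (x - y) = -Real.sin (y - x) := fun x y => by
    rw [← Real.sin_neg, neg_sub]
  have hc : ∀ x y : ℝ, Real.cos (x - y) = Real.cos (y - x) := fun x y => by
    rw [← Real.cos_neg, neg_sub]
  rw [hs (twistPhase φ (u + 1)), hs (twistPhase φ (u - 1)), hs (twistPhase φ (u + 3)),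
    hc _ (twistPhase φ (u + 1)), hc _ (twistPhase φ (u - 1)), hc _ (twistPhase φ (u + 3)),
    h1.1, h1.2, h2.1, h2.2, h3.1, h3.2]
  simp

lemma twistPhase_sub_two (φ : ℝ) (u : ZMod 8) :
    (Real.sin (twistPhase φ (u + 2) - twistPhase φ u) = 1 ∧
      Real.cos (twistPhase φ u - twistPhase φ (u + 2)) = 0) ∧
    (Real.sin (twistPhase φ (u - 2) - twistPhase φ u) = -1 ∧
      Real.cos (twistPhase φ u - twistPhase φ (u - 2)) = 0) := by
  obtain ⟨c1, s1⟩ := cos_sin_twistPhase φ u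
  obtain ⟨c2, s2⟩ := cos_sin_twistPhase φ (u - 2)
  rw [sub_add_cancel] at c2 s2
  have s2' : Real.sin (twistPhase φ (u - 2)) = -Real.cos (twistPhase φ u) := by linarith
  have h := Real.sin_sq_add_cos_sq (twistPhase φ u)
  simp only [Real.sin_sub, Real.cos_sub, c1, s1, ← s2, s2']
  refine ⟨⟨?_, ?_⟩, ⟨?_, ?_⟩⟩
  · linear_combination h
  · ring
  · linear_combination -h
  · ring

/-- The non-consensus equilibrium of `spinG k`. -/
noncomputable def twistedState (k : ℕ) (w : ZMod 8 × ZMod k) : ℝ := twistPhase (twistAngle k) w.1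

lemma not_isConsensus_twistedState (k : ℕ) : ¬ IsConsensus (twistedState k) := by
  rintro ⟨c, hc⟩
  have h1 := (hc (0, 0)).trans (hc (2, 0)).symm
  have h2 := congrArg Real.Angle.cos h1
  simp only [Real.Angle.cos_coe, twistedState] at h2
  have h3 := (cos_sin_twistPhase (twistAngle k) 0).1
  rw [zero_add, ← h2] at h3
  simp [twistPhase] at h3

variable (k : ℕ) [NeZero k]

lemma two_mul_blockSize_lt_real : 2 * (blockSize k : ℝ) < k := by
  exact_mod_cast two_mul_blockSize_lt k

/-- The common factor `τ` turns the trigonometric coefficients into polynomials in k and d. -/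
lemma cos_sin_twistAngle : ∃ τ > 0, Real.cos (twistAngle k) = (k - blockSize k) * τ ∧
    Real.sin (twistAngle k) = k * τ := by
  have h1 := two_mul_blockSize_lt_real k
  have h2 : (0 : ℝ) ≤ blockSize k := Nat.cast_nonneg _
  have h3 : (0 : ℝ) < k - blockSize k := by linarith
  have hc : 0 < Real.cos (twistAngle k) := Real.cos_arctan_pos _
  have ht : Real.tan (twistAngle k) = k / (k - blockSize k) := Real.tan_arctan _
  rw [Real.tan_eq_sin_div_cos, div_eq_div_iff hc.ne' h3.ne'] at ht
  refine ⟨Real.cos (twistAngle k) / (k - blockSize k), by positivity, by field_simp, ?_⟩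
  field_simp
  linarith

lemma isRegularOfDegree_spinG :
    (spinG k).IsRegularOfDegree (5 * k + ⌈(k : ℝ) / 2⌉₊ - 2) := by
  rintro ⟨u, i⟩
  have h := sum_neighborFinset_spinG k u i fun _ => 1
  simp only [Finset.sum_const, Finset.card_univ, ZMod.card, Finset.card_range, nsmul_eq_mul,
    mul_one, ite_self, SimpleGraph.card_neighborFinset_eq_degree] at h
  have h1 := blockSize_add_one k
  have hk := NeZero.pos k
  have h2 : (spinG k).degree (u, i) + 1 = 5 * k + blockSize k := by
    have : ((spinG k).degree (u, i) : ℝ) + 1 = 5 * k + blockSize k := by rw [h]; ring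
    exact_mod_cast this
  omega

/-- The `E_b` forces cancel as ±k; what remains is ±(k sin φ - k cos φ - d sin φ), zero by the
choice of φ. -/
lemma isKuramotoEquilibrium_twistedState : IsKuramotoEquilibrium (spinG k) (twistedState k) := by
  rintro ⟨u, i⟩
  obtain ⟨τ, hτ, hc, hs⟩ := cos_sin_twistAngle k
  rw [sum_neighborFinset_spinG]
  obtain ⟨⟨b1, -⟩, ⟨b2, -⟩⟩ := twistPhase_sub_two (twistAngle k) u
  simp only [twistedState, Finset.sum_const, Finset.card_univ, ZMod.card, Finset.card_range,
    nsmul_eq_mul, b1, b2, sub_self, Real.sin_zero]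
  by_cases hu : arcD u (u + 5)
  · obtain ⟨⟨h1, -⟩, ⟨h2, -⟩, ⟨h3, -⟩⟩ := twistPhase_sub_of_even (twistAngle k) hu
    rw [if_pos hu, h1, h2, h3, hc, hs]
    ring
  · obtain ⟨⟨h1, -⟩, ⟨h2, -⟩, ⟨h3, -⟩⟩ := twistPhase_sub_of_odd (twistAngle k) hu
    rw [if_neg hu, h1, h2, h3, hc, hs]
    ring

/-- The contribution of the fibre over an even vertex to the Hessian form. -/
lemma hessianForm_fibre_even_ge {τ : ℝ} (hc : Real.cos (twistAngle k) = (k - blockSize k) * τ)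
    (hs : Real.sin (twistAngle k) = k * τ) (x : ZMod 8 × ZMod k → ℝ)
    {s m : ZMod 8 → ℝ} (hsdef : ∀ u, s u = fibreDev fun i => x (u, i))
    (hmdef : ∀ u, m u = fibreMean fun i => x (u, i)) {u v w z : ZMod 8}
    (hu : arcD u (u + 5)) (hv : v = u + 1) (hw : w = u - 1) (hz : z = u + 5) :
    fibreBound k (blockSize k) τ (s u) (m u) (s v) (m v) (s w) (m w) (s z) (m z) ≤
    ∑ i, ∑ y ∈ (spinG k).neighborFinset (u, i),
      Real.cos (twistedState k (u, i) - twistedState k y) * (x (u, i) - x y) ^ 2 := by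
  subst hv hw hz
  unfold fibreBound
  obtain ⟨⟨-, b1⟩, ⟨-, b2⟩⟩ := twistPhase_sub_two (twistAngle k) u
  obtain ⟨⟨-, h1⟩, ⟨-, h2⟩, ⟨-, h3⟩⟩ := twistPhase_sub_of_even (twistAngle k) hu
  simp only [sum_neighborFinset_spinG, if_pos hu, twistedState, h1, h2, h3, b1, b2, sub_self,
    Real.cos_zero, ← Finset.mul_sum, Finset.sum_add_distrib, Finset.sum_sub_distrib]
  have t0 := sum_sum_sq_sub (fun i => x (u, i)) (fun i => x (u, i))
  have t1 := sum_sum_sq_sub (fun i => x (u, i)) (fun i => x (u + 1, i))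
  have t2 := sum_sum_sq_sub (fun i => x (u, i)) (fun i => x (u - 1, i))
  have t3 := sum_range_sq_sub_le (fun i => x (u, i)) (fun i => x (u + 5, i)) (blockSize k)
    fun h => (h : ZMod k)
  simp only [← hsdef, ← hmdef] at t0 t1 t2 t3
  -- The `E_d` edges enter with coefficient -cos φ, so cos φ ≥ 0 turns the upper bound `t3` into a
  -- lower bound.
  have hC : 0 ≤ (k - blockSize k) * τ := hc ▸ (Real.cos_arctan_pos _).le
  have t4 := mul_le_mul_of_nonneg_left t3 hC
  rw [t0, t1, t2, hc, hs]
  simp only [Finset.sum_const_zero, ne_eq, OfNat.ofNat_ne_zero, not_false_eq_true, zero_pow]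
  linarith

/-- The contribution of the fibre over an odd vertex to the Hessian form. -/
lemma hessianForm_fibre_odd_ge {τ : ℝ} (hc : Real.cos (twistAngle k) = (k - blockSize k) * τ)
    (hs : Real.sin (twistAngle k) = k * τ) (x : ZMod 8 × ZMod k → ℝ)
    {s m : ZMod 8 → ℝ} (hsdef : ∀ u, s u = fibreDev fun i => x (u, i))
    (hmdef : ∀ u, m u = fibreMean fun i => x (u, i)) {u v w z : ZMod 8}
    (hu : ¬ arcD u (u + 5)) (hv : v = u - 1) (hw : w = u + 1) (hz : z = u + 3) :
    fibreBound k (blockSize k) τ (s u) (m u) (s v) (m v) (s w) (m w) (s z) (m z) ≤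
    ∑ i, ∑ y ∈ (spinG k).neighborFinset (u, i),
      Real.cos (twistedState k (u, i) - twistedState k y) * (x (u, i) - x y) ^ 2 := by
  subst hv hw hz
  unfold fibreBound
  obtain ⟨⟨-, b1⟩, ⟨-, b2⟩⟩ := twistPhase_sub_two (twistAngle k) u
  obtain ⟨⟨-, h1⟩, ⟨-, h2⟩, ⟨-, h3⟩⟩ := twistPhase_sub_of_odd (twistAngle k) hu
  simp only [sum_neighborFinset_spinG, if_neg hu, twistedState, h1, h2, h3, b1, b2, sub_self,
    Real.cos_zero, ← Finset.mul_sum, Finset.sum_add_distrib, Finset.sum_sub_distrib]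
  have t0 := sum_sum_sq_sub (fun i => x (u, i)) (fun i => x (u, i))
  have t1 := sum_sum_sq_sub (fun i => x (u, i)) (fun i => x (u + 1, i))
  have t2 := sum_sum_sq_sub (fun i => x (u, i)) (fun i => x (u - 1, i))
  have t3 := sum_range_sq_sub_le (fun i => x (u, i)) (fun i => x (u + 3, i)) (blockSize k)
    -- Odd fibres receive the `E_d` edges, so the offsets run backwards.
    fun h => -(h : ZMod k)
  simp only [← hsdef, ← hmdef, ← sub_eq_add_neg] at t0 t1 t2 t3
  have hC : 0 ≤ (k - blockSize k) * τ := hc ▸ (Real.cos_arctan_pos _).le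
  have t4 := mul_le_mul_of_nonneg_left t3 hC
  rw [t0, t1, t2, hc, hs]
  simp only [Finset.sum_const_zero, ne_eq, OfNat.ofNat_ne_zero, not_false_eq_true, zero_pow]
  linarith

lemma sum_zmod_eight (g : ZMod 8 → ℝ) :
    ∑ u, g u = g 0 + g 1 + g 2 + g 3 + g 4 + g 5 + g 6 + g 7 := Fin.sum_univ_eight g

lemma hessianForm_twistedState_pos (x : ZMod 8 × ZMod k → ℝ) (hx : x ≠ 0)
    (hsum : ∑ w, x w = 0) : 0 < hessianForm (spinG k) (twistedState k) x := by
  by_contra! hle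
  obtain ⟨τ, hτ, hc, hs⟩ := cos_sin_twistAngle k
  have hdk := two_mul_blockSize_lt_real k
  have hd0 : (0 : ℝ) ≤ blockSize k := Nat.cast_nonneg _
  have hk : (0 : ℝ) < k := by linarith
  obtain ⟨s, hsdef⟩ : ∃ s : ZMod 8 → ℝ, ∀ u, s u = fibreDev fun i => x (u, i) :=
    ⟨_, fun _ => rfl⟩
  obtain ⟨m, hmdef⟩ : ∃ m : ZMod 8 → ℝ, ∀ u, m u = fibreMean fun i => x (u, i) :=
    ⟨_, fun _ => rfl⟩
  have even := fun u v w z => hessianForm_fibre_even_ge k hc hs x hsdef hmdef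
    (u := u) (v := v) (w := w) (z := z)
  have odd := fun u v w z => hessianForm_fibre_odd_ge k hc hs x hsdef hmdef
    (u := u) (v := v) (w := w) (z := z)
  have r0 := even 0 1 7 5 (by decide) (by decide) (by decide) (by decide)
  have r1 := odd 1 0 2 4 (by decide) (by decide) (by decide) (by decide)
  have r2 := even 2 3 1 7 (by decide) (by decide) (by decide) (by decide)
  have r3 := odd 3 2 4 6 (by decide) (by decide) (by decide) (by decide)
  have r4 := even 4 5 3 1 (by decide) (by decide) (by decide) (by decide)
  have r5 := odd 5 4 6 0 (by decide) (by decide) (by decide) (by decide)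
  have r6 := even 6 7 5 3 (by decide) (by decide) (by decide) (by decide)
  have r7 := odd 7 6 0 2 (by decide) (by decide) (by decide) (by decide)
  rw [hessianForm, Fintype.sum_prod_type, sum_zmod_eight] at hle
  have total := (add_le_add (add_le_add (add_le_add (add_le_add (add_le_add (add_le_add
    (add_le_add r0 r1) r2) r3) r4) r5) r6) r7).trans hle
  rw [sum_fibreBound, ← sum_zmod_eight s] at total
  have hκ : 0 < k + (k - blockSize k) * τ * (k - 2 * blockSize k) + k * τ * (k : ℝ) := by
    have : 0 < (k - blockSize k) * τ * (k - 2 * blockSize k) :=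
      mul_pos (mul_pos (by linarith) hτ) (by linarith)
    positivity
  generalize (k + (k - blockSize k) * τ * (k - 2 * blockSize k) + k * τ * k : ℝ) = κ at hκ total
  have hs0 : ∀ u, 0 ≤ s u := fun u => hsdef u ▸ fibreDev_nonneg _
  have hS : 0 ≤ ∑ u, s u := Finset.sum_nonneg fun u _ => hs0 u
  -- `total` bounds a positive combination of deviations and ring form by zero. So the ring form is
  -- nonpositive and the means agree; then the deviations vanish, `x` is constant, and its zero sum
  -- makes it zero.
  have hm := eq_of_ringForm_nonpos (m0 := m 0) (m1 := m 1) (m2 := m 2) (m3 := m 3) (m4 := m 4)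
    (m5 := m 5) (m6 := m 6) (m7 := m 7) hd0 hdk (by
      by_contra! h
      have h1 := mul_pos (mul_pos hk hτ) h
      have h2 := mul_nonneg hκ.le hS
      linarith)
  obtain ⟨e1, e2, e3, e4, e5, e6, e7⟩ := hm
  have hm : ∀ u, m u = m 0 := fun u => by
    have hu : ∀ u : ZMod 8, u = 0 ∨ u = 1 ∨ u = 2 ∨ u = 3 ∨ u = 4 ∨ u = 5 ∨ u = 6 ∨ u = 7 := by
      decide
    rcases hu u with rfl | rfl | rfl | rfl | rfl | rfl | rfl | rfl <;> first | rfl | assumption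
  have hF0 : ringForm k (blockSize k) (m 0) (m 1) (m 2) (m 3) (m 4) (m 5) (m 6) (m 7) = 0 := by
    rw [e1, e2, e3, e4, e5, e6, e7]
    simp [ringForm]
  have hS0 : ∑ u, s u = 0 := by
    refine le_antisymm ?_ hS
    by_contra! h
    have h1 := mul_pos hκ h
    rw [hF0] at total
    linarith
  have hxm : ∀ u i, x (u, i) = m 0 := fun u i => by
    have h1 := (Finset.sum_eq_zero_iff_of_nonneg fun u _ => hs0 u).mp hS0 u (Finset.mem_univ u)
    rw [hsdef] at h1
    rw [← hm u, hmdef, ← eq_fibreMean_of_fibreDev_eq_zero h1 i]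
  refine hx (funext fun ⟨u, i⟩ => ?_)
  rw [Fintype.sum_prod_type] at hsum
  simp only [hxm, Finset.sum_const, Finset.card_univ, ZMod.card, nsmul_eq_mul] at hsum
  rw [hxm]
  have : (8 * k : ℝ) * m 0 = 0 := by push_cast at hsum; linarith
  exact (mul_eq_zero.mp this).resolve_left (by positivity)

end TwistedState

/-! ### Strong densities and the bound on the critical connectivity. -/

section CriticalConnectivity

lemma strongDensity_spinG (k : ℕ) [NeZero k] :
    strongDensity (spinG k) = (5 * k + ⌈(k : ℝ) / 2⌉₊ - 2) / (8 * k - 1) := by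
  have hk := NeZero.pos k
  rw [strongDensity, (isRegularOfDegree_spinG k).minDegree_eq, Fintype.card_prod, ZMod.card,
    ZMod.card, Nat.cast_sub (by omega)]
  push_cast
  rfl

lemma tendsto_strongDensity_spinG :
    Tendsto (fun k : ℕ => strongDensity (spinG (k + 1))) atTop (𝓝 (11 / 16)) := by
  have hinv : Tendsto (fun k : ℕ => ((k + 1 : ℕ) : ℝ)⁻¹) atTop (𝓝 0) :=
    (tendsto_inv_atTop_nhds_zero_nat).comp (tendsto_add_atTop_nat 1)
  have hceil : Tendsto (fun k : ℕ => (⌈((k + 1 : ℕ) : ℝ) / 2⌉₊ : ℝ) * ((k + 1 : ℕ) : ℝ)⁻¹) atTop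
      (𝓝 (1 / 2)) := by
    have hup : Tendsto (fun k : ℕ => 1 / 2 + ((k + 1 : ℕ) : ℝ)⁻¹) atTop (𝓝 (1 / 2)) := by
      simpa using hinv.const_add (1 / 2 : ℝ)
    refine tendsto_of_tendsto_of_tendsto_of_le_of_le tendsto_const_nhds hup ?_ ?_
    · intro k
      have := Nat.le_ceil (((k + 1 : ℕ) : ℝ) / 2)
      have hk : (0 : ℝ) < ((k + 1 : ℕ) : ℝ) := by positivity
      simp only
      rw [← div_eq_mul_inv, le_div_iff₀ hk]
      linarith
    · intro k
      have := (Nat.ceil_lt_add_one (show 0 ≤ ((k + 1 : ℕ) : ℝ) / 2 by positivity)).le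
      have hk : (0 : ℝ) < ((k + 1 : ℕ) : ℝ) := by positivity
      simp only
      rw [← div_eq_mul_inv, div_le_iff₀ hk, add_mul, inv_mul_cancel₀ hk.ne']
      linarith
  -- Numerator and denominator of the density, each divided by k + 1.
  have hlim := ((hceil.const_add 5).sub (hinv.const_mul 2)).div
    ((hinv.const_sub 8)) (by norm_num)
  have hval : ((5 : ℝ) + 1 / 2 - 2 * 0) / (8 - 0) = 11 / 16 := by norm_num
  rw [hval] at hlim
  refine hlim.congr fun k => ?_
  have hk : (0 : ℝ) < ((k + 1 : ℕ) : ℝ) := by positivity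
  rw [strongDensity_spinG, Pi.div_apply]
  generalize (⌈((k + 1 : ℕ) : ℝ) / 2⌉₊ : ℝ) = c
  generalize ((k + 1 : ℕ) : ℝ) = y at hk
  rw [← mul_div_mul_right _ _ hk.ne']
  congr 1 <;> field_simp

lemma strongDensity_le_one {V : Type*} [Fintype V] [Nonempty V] (G : SimpleGraph V)
    [DecidableRel G.Adj] : strongDensity G ≤ 1 := by
  obtain ⟨v⟩ := ‹Nonempty V›
  have h1 : G.minDegree + 1 ≤ Fintype.card V :=
    (G.minDegree_le_degree v).trans_lt (G.degree_lt_card_verts v)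
  have h2 : (G.minDegree : ℝ) + 1 ≤ Fintype.card V := by exact_mod_cast h1
  -- A single vertex gives denominator 0, and division by zero returns the conventional density 0.
  exact div_le_one_of_le₀ (by linarith) (by have := Nat.cast_nonneg (α := ℝ) G.minDegree; linarith)

lemma not_synchronizes_spinG (k : ℕ) [NeZero k] : ¬ Synchronizes (spinG k) :=
  not_synchronizes_of_hessianForm_pos _ (isKuramotoEquilibrium_twistedState k)
    (hessianForm_twistedState_pos k) (not_isConsensus_twistedState k)

lemma le_criticalConnectivity : 11 / 16 ≤ criticalConnectivity := by
  -- The infimum is over a nonempty set: no density exceeds 1, so 1 belongs to it vacuously.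
  refine le_csInf ⟨1, ?_⟩ fun μ hμ => ?_
  · intro V _ _ G _ h
    exact absurd h (strongDensity_le_one G).not_gt
  · by_contra! hlt
    obtain ⟨k, hk⟩ := (tendsto_strongDensity_spinG.eventually_const_lt hlt).exists
    exact not_synchronizes_spinG (k + 1) (hμ _ (spinG (k + 1)) hk)

end CriticalConnectivity

theorem mainTheorem1 :
    11 / 16 ≤ criticalConnectivity ∧
    (∀ (k : ℕ) [NeZero k],
      Fintype.card (ZMod 8 × ZMod k) = 8 * k ∧
      (spinG k).IsRegularOfDegree (5 * k + ⌈(k : ℝ) / 2⌉₊ - 2) ∧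
      (∃ θ : ZMod 8 × ZMod k → ℝ,
        IsLinearlyStableEquilibrium (spinG k) θ ∧ ¬ IsConsensus θ) ∧
      ¬ Synchronizes (spinG k)) ∧
    Tendsto (fun k : ℕ => strongDensity (spinG (k + 1))) atTop (𝓝 (11 / 16)) := by
  refine ⟨le_criticalConnectivity, fun k _ => ⟨?_, isRegularOfDegree_spinG k,
    ⟨twistedState k, ?_, not_isConsensus_twistedState k⟩, not_synchronizes_spinG k⟩,
    tendsto_strongDensity_spinG⟩
  · rw [Fintype.card_prod, ZMod.card, ZMod.card]
  · exact (isKuramotoEquilibrium_twistedState k).isLinearlyStable _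
      (hessianForm_twistedState_pos k)
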